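/- Let $(\Omega,\mathcal F,\mathbb P)$ be a probability space with a measurable, measure-preserving, ergodic action $(\tau_x)_{x\in\mathbb R}$ of $\mathbb R$. Let $a,V:\mathbb R\times\Omega\to[0,1]$ be measurable and stationary ($f(x+y,\omega)=f(x,\tau_y\omega)$ for $f=a,V$), let $\sqrt{a(\cdot,\omega)}$ and $V(\cdot,\omega)$ be $\kappa$-Lipschitz for every $\omega$, for some $\kappa\in(0,\infty)$, and suppose that almost surely $\operatorname{ess\,inf}_x V(x,\omega)=0$ and $\operatorname{ess\,sup}_x V(x,\omega)=1$. Let $\beta\ge 0$, $\gamma>1$, $\alpha_0,\alpha_1>0$, and let $G:\mathbb R\to[0,\infty)$ be continuous with $$\alpha_0|p|^\gamma-\tfrac1{\alpha_0}\le G(p)\le\alpha_1(|p|^\gamma+1),\qquad |G(p)-G(q)|\le\alpha_1(|p|+|q|+1)^{\gamma-1}|p-q|\qquad(p,q\in\mathbb R).$$ For $\theta\in\mathbb R$ let $u_\theta(\cdot,\cdot,\omega)$ be the unique viscosity solution, uniformly continuous on $[0,\infty)\times\mathbb R$, of $$\partial_t u=a(x,\omega)\,\partial^2_{xx}u+G(\partial_x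 u)+\beta V(x,\omega)\ \text{ in }(0,\infty)\times\mathbb R,\qquad u(0,x)=\theta x,$$ and let $\mathcal H^L_\beta(G)(\theta)$ and $\mathcal H^U_\beta(G)(\theta)$ be the almost surely constant values of $\liminf_{t\to\infty}u_\theta(t,0,\omega)/t$ and $\limsup_{t\to\infty}u_\theta(t,0,\omega)/t$, respectively. The scaled hill (respectively, scaled valley) condition says: for every $h\in(0,1)$ and $y>0$, for almost every $\omega$ there are $\ell_1<\ell_2$ in $\mathbb R$ and $\delta\in(0,1)$ such that $\int_{\ell_1}^{\ell_2}\frac{dx}{\max\{a(x,\omega),\delta\}}=2y$ and $V(\cdot,\omega)\ge h$ (respectively, $V(\cdot,\omega)\le h$) on $[\ell_1,\ell_2]$. (1) If the scaled hill condition holds, then $\mathcal H^L_\beta(G)(\theta)\ge\beta$ for every $\theta\in\mathbb R$. (2) If the scaled valley condition holds and $G(c)=G(-c)=0$ for some $c\ge0$, then $\mathcal H^U_\beta(G)(\theta)\le\max\{\beta,\max_{[-c,c]}G\}$ for every $\theta$ with $|\theta|\le c$. -/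

import Mathlib

open MeasureTheory Filter Topology
open scoped NNReal

noncomputable section

/-- A measurable, measure preserving, ergodic action `(τ_x)` of `ℝ` on the probability
space `(Ω, P)`. -/
structure IsErgodicShift {Ω : Type*} [MeasurableSpace Ω] (P : Measure Ω)
    (τ : ℝ → Ω → Ω) : Prop where
  measurable : Measurable (fun p : ℝ × Ω => τ p.1 p.2)
  zero : τ 0 = id
  add : ∀ x y : ℝ, τ (x + y) = τ x ∘ τ y
  preserving : ∀ (x : ℝ) (E : Set Ω), MeasurableSet E → P (τ x '' E) = P E
  ergodic : ∀ f : Ω → ℝ, Measurable f → (∀ x : ℝ, ∀ᵐ ω ∂P, f (τ x ω) = f ω) →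
    ∃ k : ℝ, ∀ᵐ ω ∂P, f ω = k

/-- A jointly measurable process `f(x, ω)`, stationary with respect to the shifts `τ`. -/
structure IsStationaryProcess {Ω : Type*} [MeasurableSpace Ω]
    (τ : ℝ → Ω → Ω) (f : ℝ → Ω → ℝ) : Prop where
  measurable : Measurable (fun p : ℝ × Ω => f p.1 p.2)
  stationary : ∀ (x y : ℝ) (ω : Ω), f (x + y) ω = f x (τ y ω)

/-- The standing assumptions on the random medium: `a, V : ℝ × Ω → [0,1]` are stationary,
`√a(·, ω)` and `V(·, ω)` are `κ`-Lipschitz for every `ω` (hence `a` and `V` are continuous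
in `x`), and almost surely `ess inf V = 0` and `ess sup V = 1`. -/
structure IsMedium {Ω : Type*} [MeasurableSpace Ω] (P : Measure Ω) (τ : ℝ → Ω → Ω)
    (κ : ℝ≥0) (a V : ℝ → Ω → ℝ) : Prop where
  shift : IsErgodicShift P τ
  a_stationary : IsStationaryProcess τ a
  V_stationary : IsStationaryProcess τ V
  a_mem : ∀ x ω, a x ω ∈ Set.Icc (0 : ℝ) 1
  V_mem : ∀ x ω, V x ω ∈ Set.Icc (0 : ℝ) 1
  a_lipschitz : ∀ ω, LipschitzWith κ (fun x => √(a x ω))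
  V_lipschitz : ∀ ω, LipschitzWith κ (fun x => V x ω)
  V_essInf : ∀ᵐ ω ∂P, essInf (fun x => V x ω) volume = 0
  V_essSup : ∀ᵐ ω ∂P, essSup (fun x => V x ω) volume = 1

/-- The scaled hill condition. -/
def ScaledHill {Ω : Type*} [MeasurableSpace Ω] (P : Measure Ω) (a V : ℝ → Ω → ℝ) : Prop :=
  ∀ h ∈ Set.Ioo (0 : ℝ) 1, ∀ y : ℝ, 0 < y → ∀ᵐ ω ∂P,
    ∃ l₁ l₂ δ : ℝ, l₁ < l₂ ∧ δ ∈ Set.Ioo (0 : ℝ) 1 ∧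
      (∫ x in l₁..l₂, 1 / max (a x ω) δ) = 2 * y ∧
      ∀ x ∈ Set.Icc l₁ l₂, h ≤ V x ω

/-- The scaled valley condition. -/
def ScaledValley {Ω : Type*} [MeasurableSpace Ω] (P : Measure Ω) (a V : ℝ → Ω → ℝ) : Prop :=
  ∀ h ∈ Set.Ioo (0 : ℝ) 1, ∀ y : ℝ, 0 < y → ∀ᵐ ω ∂P,
    ∃ l₁ l₂ δ : ℝ, l₁ < l₂ ∧ δ ∈ Set.Ioo (0 : ℝ) 1 ∧
      (∫ x in l₁..l₂, 1 / max (a x ω) δ) = 2 * y ∧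
      ∀ x ∈ Set.Icc l₁ l₂, V x ω ≤ h

/-- The class `ℋ(γ, α₀, α₁)` of Hamiltonians. -/
structure HamiltonianClass (γ α₀ α₁ : ℝ) (G : ℝ → ℝ) : Prop where
  continuous : Continuous G
  lower : ∀ p : ℝ, α₀ * |p| ^ γ - 1 / α₀ ≤ G p
  upper : ∀ p : ℝ, G p ≤ α₁ * (|p| ^ γ + 1)
  lipschitz : ∀ p q : ℝ, |G p - G q| ≤ α₁ * (|p| + |q| + 1) ^ (γ - 1) * |p - q|

/-- Viscosity subsolution inequality for `∂ₜu = a(x) ∂ₓₓu + G(∂ₓu) + β V(x)` in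
`(0,∞) × ℝ`: the test functions `φ` are of class `C²` near the point of contact.
(Semicontinuity is not included here; it is part of `IsCauchySolution`.) -/
def IsViscositySub (a V : ℝ → ℝ) (β : ℝ) (G : ℝ → ℝ) (u : ℝ → ℝ → ℝ) : Prop :=
  ∀ (φ : ℝ → ℝ → ℝ) (t₀ x₀ : ℝ), 0 < t₀ →
    ContDiffAt ℝ 2 (fun p : ℝ × ℝ => φ p.1 p.2) (t₀, x₀) →
    IsLocalMax (fun p : ℝ × ℝ => u p.1 p.2 - φ p.1 p.2) (t₀, x₀) →
    deriv (fun t => φ t x₀) t₀ ≤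
      a x₀ * iteratedDeriv 2 (fun x => φ t₀ x) x₀ + G (deriv (fun x => φ t₀ x) x₀) + β * V x₀

/-- Viscosity supersolution inequality for the same equation. -/
def IsViscositySuper (a V : ℝ → ℝ) (β : ℝ) (G : ℝ → ℝ) (u : ℝ → ℝ → ℝ) : Prop :=
  ∀ (φ : ℝ → ℝ → ℝ) (t₀ x₀ : ℝ), 0 < t₀ →
    ContDiffAt ℝ 2 (fun p : ℝ × ℝ => φ p.1 p.2) (t₀, x₀) →
    IsLocalMin (fun p : ℝ × ℝ => u p.1 p.2 - φ p.1 p.2) (t₀, x₀) →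
    a x₀ * iteratedDeriv 2 (fun x => φ t₀ x) x₀ + G (deriv (fun x => φ t₀ x) x₀) + β * V x₀ ≤
      deriv (fun t => φ t x₀) t₀

/-- `u` is the solution `u_θ`: it is uniformly continuous on `[0,∞) × ℝ`, solves the equation
in `(0,∞) × ℝ` in the viscosity sense, and `u(0, x) = θ x`. (Its values at negative times
are irrelevant.) -/
structure IsCauchySolution (a V : ℝ → ℝ) (β : ℝ) (G : ℝ → ℝ) (θ : ℝ)
    (u : ℝ → ℝ → ℝ) : Prop where
  uniformContinuousOn :
    UniformContinuousOn (fun p : ℝ × ℝ => u p.1 p.2) (Set.Ici (0 : ℝ) ×ˢ Set.univ)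
  sub : IsViscositySub a V β G u
  super : IsViscositySuper a V β G u
  initial : ∀ x : ℝ, u 0 x = θ * x

/-- `liminf_{t → ∞} u_θ(t, 0) / t` for one realization of the medium. The Cauchy problem is
well posed, so the infimum ranges over the single function `u_θ`. -/
def lowerRate (a V : ℝ → ℝ) (β : ℝ) (G : ℝ → ℝ) (θ : ℝ) : EReal :=
  ⨅ (u : ℝ → ℝ → ℝ) (_ : IsCauchySolution a V β G θ u),
    liminf (fun t : ℝ => ((u t 0 / t : ℝ) : EReal)) atTop

/-- `limsup_{t → ∞} u_θ(t, 0) / t` for one realization of the medium. The Cauchy problem is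
well posed, so the supremum ranges over the single function `u_θ`. -/
def upperRate (a V : ℝ → ℝ) (β : ℝ) (G : ℝ → ℝ) (θ : ℝ) : EReal :=
  ⨆ (u : ℝ → ℝ → ℝ) (_ : IsCauchySolution a V β G θ u),
    limsup (fun t : ℝ => ((u t 0 / t : ℝ) : EReal)) atTop

/-- `ℋ^L_β(G)(θ)`: the deterministic value of `liminf_{t → ∞} u_θ(t, 0, ω) / t`. The latter is
almost surely constant, so its essential infimum is that constant (see
`effectiveLower_eq`). -/
def effectiveLower {Ω : Type*} [MeasurableSpace Ω] (P : Measure Ω) (a V : ℝ → Ω → ℝ)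
    (β : ℝ) (G : ℝ → ℝ) (θ : ℝ) : EReal :=
  essInf (fun ω => lowerRate (fun x => a x ω) (fun x => V x ω) β G θ) P

/-- `ℋ^U_β(G)(θ)`: the deterministic value of `limsup_{t → ∞} u_θ(t, 0, ω) / t`. The latter is
almost surely constant, so its essential supremum is that constant (see
`effectiveUpper_eq`). -/
def effectiveUpper {Ω : Type*} [MeasurableSpace Ω] (P : Measure Ω) (a V : ℝ → Ω → ℝ)
    (β : ℝ) (G : ℝ → ℝ) (θ : ℝ) : EReal :=
  essSup (fun ω => upperRate (fun x => a x ω) (fun x => V x ω) β G θ) P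

/-- If almost surely `u_θ(·, ·, ω)` is the unique solution and
`liminf_{t → ∞} u_θ(t, 0, ω) / t = r`, then `ℋ^L_β(G)(θ) = r`. -/
theorem effectiveLower_eq {Ω : Type*} [MeasurableSpace Ω] (P : Measure Ω)
    [IsProbabilityMeasure P] (a V : ℝ → Ω → ℝ) (β : ℝ) (G : ℝ → ℝ) (θ : ℝ)
    (u : Ω → ℝ → ℝ → ℝ) (r : EReal)
    (hu : ∀ᵐ ω ∂P, IsCauchySolution (fun x => a x ω) (fun x => V x ω) β G θ (u ω) ∧
      ∀ v, IsCauchySolution (fun x => a x ω) (fun x => V x ω) β G θ v →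
        ∀ t x : ℝ, 0 ≤ t → v t x = u ω t x)
    (hr : ∀ᵐ ω ∂P, liminf (fun t : ℝ => ((u ω t 0 / t : ℝ) : EReal)) atTop = r) :
    effectiveLower P a V β G θ = r := by
  have key : (fun ω => lowerRate (fun x => a x ω) (fun x => V x ω) β G θ)
      =ᵐ[P] fun _ => r := by
    filter_upwards [hu, hr] with ω h1 h2
    refine le_antisymm ((iInf₂_le (u ω) h1.1).trans h2.le) (le_iInf₂ fun v hv => ?_)
    rw [← h2]
    refine (liminf_congr ?_).le
    filter_upwards [eventually_ge_atTop (0 : ℝ)] with t ht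
    rw [h1.2 v hv t 0 ht]
  rw [effectiveLower, essInf_congr_ae key,
    essInf_const _ (IsProbabilityMeasure.ne_zero P)]

/-- If almost surely `u_θ(·, ·, ω)` is the unique solution and
`limsup_{t → ∞} u_θ(t, 0, ω) / t = r`, then `ℋ^U_β(G)(θ) = r`. -/
theorem effectiveUpper_eq {Ω : Type*} [MeasurableSpace Ω] (P : Measure Ω)
    [IsProbabilityMeasure P] (a V : ℝ → Ω → ℝ) (β : ℝ) (G : ℝ → ℝ) (θ : ℝ)
    (u : Ω → ℝ → ℝ → ℝ) (r : EReal)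
    (hu : ∀ᵐ ω ∂P, IsCauchySolution (fun x => a x ω) (fun x => V x ω) β G θ (u ω) ∧
      ∀ v, IsCauchySolution (fun x => a x ω) (fun x => V x ω) β G θ v →
        ∀ t x : ℝ, 0 ≤ t → v t x = u ω t x)
    (hr : ∀ᵐ ω ∂P, limsup (fun t : ℝ => ((u ω t 0 / t : ℝ) : EReal)) atTop = r) :
    effectiveUpper P a V β G θ = r := by
  have key : (fun ω => upperRate (fun x => a x ω) (fun x => V x ω) β G θ)
      =ᵐ[P] fun _ => r := by
    filter_upwards [hu, hr] with ω h1 h2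
    refine le_antisymm (iSup₂_le fun v hv => ?_)
      (h2.ge.trans (le_iSup₂_of_le (u ω) h1.1 le_rfl))
    rw [← h2]
    refine (limsup_congr ?_).le
    filter_upwards [eventually_ge_atTop (0 : ℝ)] with t ht
    rw [h1.2 v hv t 0 ht]
  rw [effectiveUpper, essSup_congr_ae key,
    essSup_const _ (IsProbabilityMeasure.ne_zero P)]

end

open MeasureTheory Filter Topology
open scoped NNReal

/-! Compare `u` with a barrier that is affine in time with a convex profile `f`. If `f'' = ε / max a
δ`, then `a f'' ≤ ε` even where `a` degenerates, and an interval with `∫ 1 / max a δ = 2K / ε` is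
exactly wide enough for `f'` to climb from `-K` to `K` (`exists_convex_barrier`). Taking `K > |θ|`
makes `f` dominate the initial slope, so comparison reduces to a maximum over a compact set
(`IsViscositySub.le_add_mul`). Hill (`le_lowerRate_of_hill`): `-f` gives a subsolution. On the hill
the potential supplies `β h`; off it `|f'| ≥ K`, and coercivity supplies `G ≥ β`. Valley
(`upperRate_le_of_valley`): `f` gives a supersolution with `K` slightly above `c`. In the valley `V`
is small and `G` is at most about its maximum on `[-c, c]`; outside, `f''` is damped so that `|f'|`
stays near `c`, where `G` is small, and `V` costs at most `β`. Letting `ε → 0` gives both bounds. -/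

/-! ### Comparison with barriers that are affine in time. -/

/-- A function that is uniformly continuous on `[0,∞) × ℝ` grows at most linearly in time,
uniformly in space. -/
theorem exists_time_growth_bound {u : ℝ → ℝ → ℝ}
    (hu : UniformContinuousOn (fun p : ℝ × ℝ => u p.1 p.2) (Set.Ici (0 : ℝ) ×ˢ Set.univ)) :
    ∃ C : ℝ, 0 ≤ C ∧ ∀ t x : ℝ, 0 ≤ t → |u t x - u 0 x| ≤ C * t + 1 := by
  obtain ⟨δ, hδ, h⟩ := Metric.uniformContinuousOn_iff.1 hu 1 one_pos
  have step : ∀ s t x : ℝ, 0 ≤ s → 0 ≤ t → |t - s| < δ → |u t x - u s x| < 1 := by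
    intro s t x hs ht hst
    have := h (t, x) ⟨ht, trivial⟩ (s, x) ⟨hs, trivial⟩ (by
      rw [Prod.dist_eq, Real.dist_eq, dist_self]
      exact max_lt hst hδ)
    simpa [Real.dist_eq] using this
  have main : ∀ (n : ℕ) (t x : ℝ), 0 ≤ t → t ≤ n * (δ / 2) → |u t x - u 0 x| ≤ n := by
    intro n
    induction n with
    | zero =>
      intro t x h0 h1
      have : t = 0 := le_antisymm (by simpa using h1) h0
      simp [this]
    | succ n ih =>
      intro t x h0 h1
      push_cast at h1 ⊢
      have hs : (0 : ℝ) ≤ max 0 (t - δ / 2) := le_max_left _ _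
      have h2 := ih (max 0 (t - δ / 2)) x hs (max_le (by positivity) (by linarith))
      have h3 := step (max 0 (t - δ / 2)) t x hs h0 (by
        rw [abs_lt]
        constructor
        · linarith [max_le h0 (by linarith : t - δ / 2 ≤ t)]
        · linarith [le_max_right 0 (t - δ / 2)])
      have h4 := abs_sub_le (u t x) (u (max 0 (t - δ / 2)) x) (u 0 x)
      linarith
  -- Each time step of length `δ / 2` costs at most 1; rounding up the number of steps costs the
  -- extra 1.
  refine ⟨2 / δ, by positivity, fun t x ht => ?_⟩
  have h1 : t ≤ ⌈2 / δ * t⌉₊ * (δ / 2) := by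
    have := Nat.le_ceil (2 / δ * t)
    calc t = 2 / δ * t * (δ / 2) := by field_simp
      _ ≤ _ := by gcongr
  exact (main _ t x ht h1).trans (Nat.ceil_lt_add_one (by positivity)).le

/-- Comparison of a viscosity subsolution with a classical supersolution of the form
`f x + c * t`, where `f` grows faster than the initial value `θ * x`. -/
theorem IsViscositySub.le_add_mul {a V : ℝ → ℝ} {β : ℝ} {G : ℝ → ℝ} {θ : ℝ} {u : ℝ → ℝ → ℝ}
    (hu : UniformContinuousOn (fun p : ℝ × ℝ => u p.1 p.2) (Set.Ici (0 : ℝ) ×ˢ Set.univ))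
    (hsub : IsViscositySub a V β G u) (h0 : ∀ x, u 0 x = θ * x)
    {f : ℝ → ℝ} (hf : ContDiff ℝ 2 f) {K C c : ℝ} (hK : |θ| < K)
    (hfK : ∀ x, K * |x| - C ≤ f x)
    (hsup : ∀ x, a x * iteratedDeriv 2 f x + G (deriv f x) + β * V x ≤ c)
    {t : ℝ} (ht : 0 ≤ t) (x : ℝ) : u t x ≤ f x + c * t + C := by
  by_contra! hlt
  obtain ⟨A, hA, hgrow⟩ := exists_time_growth_bound hu
  -- Half the excess, so that the excess at `(t, x)` survives the penalty `e * exp 0`.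
  set e := (u t x - f x - c * t - C) / 2 with he
  have he0 : 0 < e := by rw [he]; linarith
  -- The horizon lies beyond `t` because the contact point must be interior in time.
  set T := t + 1 with hT
  set B := C + A * T + 1 + |c| * T with hB
  set k := (B - C) / e with hk
  have hBC : 0 < B - C := by
    have : 0 ≤ A * T := mul_nonneg hA (by linarith)
    have : 0 ≤ |c| * T := mul_nonneg (abs_nonneg c) (by linarith)
    linarith
  have hk0 : 0 < k := div_pos hBC he0
  -- The exponential makes the time derivative strictly larger than `c`, and since `e * k = B - C`
  -- it also excludes a maximum at time `T`.
  set φ : ℝ → ℝ → ℝ := fun s z => f z + c * s + e * Real.exp (k * (s - t)) with hφ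
  -- Beyond this radius `hbound` pushes the difference below `C`, so the maximum is not on the
  -- lateral boundary.
  set R := max |x| ((B - C) / (K - |θ|)) with hR
  have hθ : ∀ z, θ * z ≤ |θ| * |z| := fun z => (le_abs_self _).trans (abs_mul θ z).le
  have hbound : ∀ s z, 0 ≤ s → s ≤ T → u s z - f z - c * s ≤ B - (K - |θ|) * |z| := by
    intro s z hs hsT
    have h1 := (abs_le.1 (hgrow s z hs)).2
    rw [h0] at h1
    have h2 : A * s ≤ A * T := by gcongr
    have h3 : -(c * s) ≤ |c| * T := by
      calc -(c * s) ≤ |c * s| := neg_le_abs _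
        _ = |c| * s := by rw [abs_mul, abs_of_nonneg hs]
        _ ≤ |c| * T := by gcongr
    linarith [hθ z, hfK z]
  have hcont : ContinuousOn (fun p : ℝ × ℝ => u p.1 p.2 - φ p.1 p.2)
      (Set.Icc 0 T ×ˢ Set.Icc (-R) R) := by
    have hfc := hf.continuous
    refine (hu.continuousOn.mono fun p hp => ⟨hp.1.1, trivial⟩).sub (Continuous.continuousOn ?_)
    simp only [hφ]
    fun_prop
  have hxR : (t, x) ∈ Set.Icc 0 T ×ˢ Set.Icc (-R) R :=
    ⟨⟨ht, by linarith⟩, abs_le.1 (le_max_left _ _)⟩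
  obtain ⟨⟨t₀, x₀⟩, ⟨⟨ht₀, ht₀T⟩, hx₀⟩, hmax⟩ :=
    (isCompact_Icc.prod isCompact_Icc).exists_isMaxOn ⟨_, hxR⟩ hcont
  have hval : C < u t₀ x₀ - φ t₀ x₀ := by
    have h1 : u t x - φ t x ≤ u t₀ x₀ - φ t₀ x₀ := hmax hxR
    simp only [hφ, sub_self, mul_zero, Real.exp_zero, mul_one] at h1 ⊢
    linarith
  have hexp : 0 < e * Real.exp (k * (t₀ - t)) := by positivity
  have hb := hbound t₀ x₀ ht₀ ht₀T
  have hKθ : 0 < K - |θ| := by linarith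
  have ht₀pos : 0 < t₀ := by
    refine lt_of_le_of_ne ht₀ fun h => ?_
    rw [← h] at hval hexp
    simp only [hφ, h0, mul_zero] at hval
    nlinarith [hθ x₀, hfK x₀, abs_nonneg x₀]
  have ht₀lt : t₀ < T := by
    refine lt_of_le_of_ne ht₀T fun h => ?_
    have h1 : k + 1 ≤ Real.exp (k * (t₀ - t)) := by
      rw [h, hT, add_sub_cancel_left, mul_one]
      exact Real.add_one_le_exp k
    have h2 : e * k = B - C := by rw [hk]; field_simp
    have h3 : e * (k + 1) ≤ e * Real.exp (k * (t₀ - t)) := by gcongr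
    have h4 : 0 ≤ (K - |θ|) * |x₀| := by positivity
    simp only [hφ] at hval
    linarith
  have hx₀lt : |x₀| < R := by
    by_contra! h
    have h1 : (B - C) / (K - |θ|) ≤ |x₀| := (le_max_right _ _).trans h
    rw [div_le_iff₀ hKθ] at h1
    simp only [hφ] at hval
    linarith
  have hloc : IsLocalMax (fun p : ℝ × ℝ => u p.1 p.2 - φ p.1 p.2) (t₀, x₀) :=
    hmax.isLocalMax (prod_mem_nhds (Icc_mem_nhds ht₀pos ht₀lt)
      (Icc_mem_nhds (abs_lt.1 hx₀lt).1 (abs_lt.1 hx₀lt).2))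
  have hφ2 : ContDiffAt ℝ 2 (fun p : ℝ × ℝ => φ p.1 p.2) (t₀, x₀) := by
    apply ContDiff.contDiffAt
    simp only [hφ]
    fun_prop
  have key := hsub φ t₀ x₀ ht₀pos hφ2 hloc
  have hdt : HasDerivAt (fun s => φ s x₀) (c + e * (Real.exp (k * (t₀ - t)) * k)) t₀ := by
    have h1 : HasDerivAt (fun s : ℝ => c * s) c t₀ := by
      simpa using (hasDerivAt_id t₀).const_mul c
    have h2 : HasDerivAt (fun s : ℝ => k * (s - t)) k t₀ := by
      simpa using ((hasDerivAt_id t₀).sub_const t).const_mul k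
    exact (h1.const_add (f x₀)).add (h2.exp.const_mul e)
  have hdx : deriv (fun z => φ t₀ z) = deriv f := by
    ext z
    simp only [hφ, deriv_add_const]
  have hdxx : iteratedDeriv 2 (fun z => φ t₀ z) = iteratedDeriv 2 f := by
    rw [iteratedDeriv_succ', hdx, ← iteratedDeriv_succ']
  rw [hdt.deriv, hdx, hdxx] at key
  have : 0 < e * (Real.exp (k * (t₀ - t)) * k) := by positivity
  linarith [hsup x₀]

/-! ### Convex profiles and control of their slopes. -/

/-- A convex function of class `C²` with prescribed second derivative `g ≥ 0`, whose slope
increases from `-K` to `K` on `[l₁, l₂]`. -/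
theorem exists_convex_barrier {g : ℝ → ℝ} (hg : Continuous g) (hg0 : ∀ x, 0 ≤ g x)
    {l₁ l₂ K : ℝ} (hK : 0 ≤ K) (hint : ∫ x in l₁..l₂, g x = 2 * K) :
    ∃ f : ℝ → ℝ, ContDiff ℝ 2 f ∧ iteratedDeriv 2 f = g ∧ Monotone (deriv f) ∧
      (∀ x, deriv f x = -K + ∫ s in l₁..x, g s) ∧ (∀ x, deriv f x = K + ∫ s in l₂..x, g s) ∧
      ∃ C, ∀ x, K * |x| - C ≤ f x := by
  set p : ℝ → ℝ := fun x => -K + ∫ s in l₁..x, g s with hp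
  have hpd : ∀ x, HasDerivAt p (g x) x := fun x =>
    (intervalIntegral.integral_hasDerivAt_right (hg.intervalIntegrable _ _)
      (hg.stronglyMeasurableAtFilter _ _) hg.continuousAt).const_add (-K)
  have hpc : Continuous p := continuous_iff_continuousAt.2 fun x => (hpd x).continuousAt
  set f : ℝ → ℝ := fun x => ∫ s in (0 : ℝ)..x, p s with hf
  have hfd : ∀ x, HasDerivAt f (p x) x := fun x =>
    intervalIntegral.integral_hasDerivAt_right (hpc.intervalIntegrable _ _)
      (hpc.stronglyMeasurableAtFilter _ _) hpc.continuousAt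
  have hdf : deriv f = p := funext fun x => (hfd x).deriv
  have hdp : deriv p = g := funext fun x => (hpd x).deriv
  have hmono : Monotone p := monotone_of_deriv_nonneg (fun x => (hpd x).differentiableAt)
    (fun x => by rw [hdp]; exact hg0 x)
  have hfdiff : Differentiable ℝ f := fun x => (hfd x).differentiableAt
  have hconv : ConvexOn ℝ Set.univ f := Monotone.convexOn_univ_of_deriv hfdiff (by rwa [hdf])
  -- The tangents at `l₁` and `l₂`, of slopes `-K` and `K`, yield the lower bound `K * |x| - C`.
  have htan : ∀ x y, f y + p y * (x - y) ≤ f x := by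
    intro x y
    rcases lt_trichotomy x y with h | h | h
    · have := hconv.slope_le_of_hasDerivAt trivial trivial h (hfd y)
      rw [slope_def_field, div_le_iff₀ (by linarith)] at this
      linarith
    · simp [h]
    · have := hconv.le_slope_of_hasDerivAt trivial trivial h (hfd y)
      rw [slope_def_field, le_div_iff₀ (by linarith)] at this
      linarith
  have hp2 : ∀ x, p x = K + ∫ s in l₂..x, g s := by
    intro x
    simp only [hp]
    rw [← intervalIntegral.integral_add_adjacent_intervals (hg.intervalIntegrable l₁ l₂)
      (hg.intervalIntegrable l₂ x), hint]
    ring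
  refine ⟨f, ?_, ?_, by rwa [hdf], fun x => by rw [hdf], fun x => by rw [hdf, hp2],
    |f l₁| + |f l₂| + K * |l₁| + K * |l₂|, fun x => ?_⟩
  · rw [show (2 : WithTop ℕ∞) = 1 + 1 by norm_num, contDiff_succ_iff_deriv]
    refine ⟨hfdiff, by simp, ?_⟩
    rw [hdf, contDiff_one_iff_deriv, hdp]
    exact ⟨fun x => (hpd x).differentiableAt, hg⟩
  · rw [iteratedDeriv_succ', iteratedDeriv_one, hdf, hdp]
  · have h1 := htan x l₁
    have h2 := htan x l₂
    rw [show p l₁ = -K by simp [hp]] at h1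
    rw [show p l₂ = K by simp [hp2]] at h2
    have h3 : K * l₂ ≤ K * |l₂| := by gcongr; exact le_abs_self _
    have h4 : K * -l₁ ≤ K * |l₁| := by gcongr; exact neg_le_abs _
    have h5 : 0 ≤ K * |l₁| := by positivity
    have h6 : 0 ≤ K * |l₂| := by positivity
    have h7 := neg_abs_le (f l₁)
    have h8 := neg_abs_le (f l₂)
    have h9 := abs_nonneg (f l₁)
    have h10 := abs_nonneg (f l₂)
    rcases abs_cases x with ⟨h, -⟩ | ⟨h, -⟩ <;> rw [h] <;> linarith

/-- Integrating the whole exponential tail gives `M / k`. This limits the slope that the valley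
barrier gains outside the valley. -/
theorem integral_le_of_le_exp {g : ℝ → ℝ} (hg : Continuous g) {M k l x : ℝ} (hM : 0 ≤ M)
    (hk : 0 < k) (hx : l ≤ x) (h : ∀ s, l ≤ s → g s ≤ M * Real.exp (-k * (s - l))) :
    ∫ s in l..x, g s ≤ M / k := by
  have hd : ∀ s, HasDerivAt (fun s => -(M / k) * Real.exp (-k * (s - l)))
      (M * Real.exp (-k * (s - l))) s := by
    intro s
    have h2 : HasDerivAt (fun s : ℝ => -k * (s - l)) (-k) s := by
      simpa using ((hasDerivAt_id s).sub_const l).const_mul (-k)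
    refine (h2.exp.const_mul (-(M / k))).congr_deriv ?_
    field_simp
  have hc : Continuous fun s => M * Real.exp (-k * (s - l)) := by fun_prop
  calc ∫ s in l..x, g s ≤ ∫ s in l..x, M * Real.exp (-k * (s - l)) :=
        intervalIntegral.integral_mono_on hx (hg.intervalIntegrable _ _)
          (hc.intervalIntegrable _ _) fun s hs => h s hs.1
    _ = M / k - M / k * Real.exp (-k * (x - l)) := by
        rw [intervalIntegral.integral_eq_sub_of_hasDerivAt (fun s _ => hd s)
          (hc.intervalIntegrable _ _)]
        simp only [sub_self, mul_zero, Real.exp_zero]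
        ring
    _ ≤ M / k := sub_le_self _ (by positivity)

theorem integral_le_of_le_exp_left {g : ℝ → ℝ} (hg : Continuous g) {M k l x : ℝ} (hM : 0 ≤ M)
    (hk : 0 < k) (hx : x ≤ l) (h : ∀ s, s ≤ l → g s ≤ M * Real.exp (-k * (l - s))) :
    ∫ s in x..l, g s ≤ M / k := by
  have h1 : ∫ s in x..l, g s = ∫ s in -l..-x, g (-s) := by
    rw [intervalIntegral.integral_comp_neg, neg_neg, neg_neg]
  rw [h1]
  refine integral_le_of_le_exp (by fun_prop) hM hk (by linarith) fun s hs => ?_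
  convert h (-s) (by linarith) using 4
  ring

/-! ### Growth rates, reflection and elementary bounds. -/

theorem limsup_div_le_of_le_add {v : ℝ → ℝ} {c C : ℝ} (h : ∀ t, 0 ≤ t → v t ≤ C + c * t) :
    limsup (fun t : ℝ => ((v t / t : ℝ) : EReal)) atTop ≤ (c : EReal) := by
  have hlim : Tendsto (fun t : ℝ => ((C / t + c : ℝ) : EReal)) atTop (𝓝 (c : EReal)) := by
    refine (continuous_coe_real_ereal.tendsto c).comp ?_
    simpa using (tendsto_id.const_div_atTop C).add_const c
  rw [← hlim.limsup_eq]
  refine limsup_le_limsup ?_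
  filter_upwards [eventually_gt_atTop 0] with t ht
  rw [EReal.coe_le_coe_iff, div_le_iff₀ ht, add_mul, div_mul_cancel₀ _ ht.ne']
  exact h t ht.le

theorem le_liminf_div_of_add_le {v : ℝ → ℝ} {c C : ℝ} (h : ∀ t, 0 ≤ t → C + c * t ≤ v t) :
    (c : EReal) ≤ liminf (fun t : ℝ => ((v t / t : ℝ) : EReal)) atTop := by
  have hlim : Tendsto (fun t : ℝ => ((C / t + c : ℝ) : EReal)) atTop (𝓝 (c : EReal)) := by
    refine (continuous_coe_real_ereal.tendsto c).comp ?_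
    simpa using (tendsto_id.const_div_atTop C).add_const c
  rw [← hlim.liminf_eq]
  refine liminf_le_liminf ?_
  filter_upwards [eventually_gt_atTop 0] with t ht
  rw [EReal.coe_le_coe_iff, le_div_iff₀ ht, add_mul, div_mul_cancel₀ _ ht.ne']
  exact h t ht.le

/-- Reflection `u ↦ -u` turns supersolutions into subsolutions. -/
theorem IsViscositySuper.neg {a V : ℝ → ℝ} {β : ℝ} {G : ℝ → ℝ} {u : ℝ → ℝ → ℝ}
    (h : IsViscositySuper a V β G u) :
    IsViscositySub a (fun x => -V x) β (fun p => -G (-p)) (fun t x => -u t x) := by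
  intro φ t₀ x₀ ht hφ hmax
  have hmin : IsLocalMin (fun p : ℝ × ℝ => u p.1 p.2 - (fun t x => -φ t x) p.1 p.2) (t₀, x₀) := by
    have := IsLocalMax.neg hmax
    refine this.congr (Eventually.of_forall fun p => ?_)
    simp only
    ring
  have key := h (fun t x => -φ t x) t₀ x₀ ht hφ.neg hmin
  simp only [deriv.fun_neg, iteratedDeriv_fun_neg] at key
  linarith

theorem continuous_of_continuous_sqrt {a : ℝ → ℝ} (h : Continuous fun x => √(a x))
    (ha : ∀ x, 0 ≤ a x) : Continuous a := by
  exact (h.pow 2).congr fun x => Real.sq_sqrt (ha x)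

theorem mul_div_max_le {b d e : ℝ} (hd : 0 < d) (he : 0 ≤ e) :
    b * (e / max b d) ≤ e := by
  have hm : 0 < max b d := lt_max_of_lt_right hd
  rw [mul_div_assoc', div_le_iff₀ hm, mul_comm]
  exact mul_le_mul_of_nonneg_left (le_max_left _ _) he

/-! ### Rate bounds for a single realization. -/

/-- On a hill of height `h` that is wide enough, every solution grows at rate at least
`β * h - ε`. -/
theorem le_lowerRate_of_hill {a V G : ℝ → ℝ} {β θ h ε K l₁ l₂ δ : ℝ} (hβ : 0 ≤ β)
    (ha : Continuous a) (hV : ∀ x, V x ∈ Set.Icc (0 : ℝ) 1)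
    (hG0 : ∀ p, 0 ≤ G p) (hε : 0 < ε) (hh : h ≤ 1) (hK : |θ| < K)
    (hGK : ∀ p, K ≤ |p| → β ≤ G p) (hδ : 0 < δ)
    (hint : ∫ x in l₁..l₂, 1 / max (a x) δ = 2 * (K / ε))
    (hhill : ∀ x ∈ Set.Icc l₁ l₂, h ≤ V x) :
    ((β * h - ε : ℝ) : EReal) ≤ lowerRate a V β G θ := by
  refine le_iInf₂ fun u hu => ?_
  have hm : ∀ x, 0 < max (a x) δ := fun x => lt_max_of_lt_right hδ
  have hg : Continuous fun x => ε / max (a x) δ :=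
    continuous_const.div (ha.max continuous_const) fun x => (hm x).ne'
  have hint' : ∫ x in l₁..l₂, ε / max (a x) δ = 2 * K := by
    simp_rw [div_eq_mul_one_div ε]
    rw [intervalIntegral.integral_const_mul, hint]
    field_simp
  have hK0 : 0 ≤ K := (abs_nonneg θ).trans hK.le
  obtain ⟨f, hf, hf2, hmono, hf₁, hf₂, C, hC⟩ :=
    exists_convex_barrier hg (fun x => (div_pos hε (hm x)).le) hK0 hint'
  have hsup : ∀ x, a x * iteratedDeriv 2 f x + (fun p => -G (-p)) (deriv f x)
      + β * (fun x => -V x) x ≤ -(β * h - ε) := by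
    intro x
    have h1 : a x * (ε / max (a x) δ) ≤ ε := mul_div_max_le hδ hε.le
    have hfl₁ : deriv f l₁ = -K := by simp [hf₁]
    have hfl₂ : deriv f l₂ = K := by simp [hf₂]
    have hVx := mul_nonneg hβ (hV x).1
    have hβh := mul_le_mul_of_nonneg_left hh hβ
    simp only [hf2]
    by_cases hx : x ∈ Set.Icc l₁ l₂
    · have h2 := mul_le_mul_of_nonneg_left (hhill x hx) hβ
      linarith [hG0 (-deriv f x)]
    · have h2 : K ≤ |-deriv f x| := by
        rw [abs_neg]
        rw [Set.mem_Icc, not_and_or, not_le, not_le] at hx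
        rcases hx with hx | hx
        · have := hmono hx.le
          rw [hfl₁] at this
          exact (by linarith : K ≤ -deriv f x).trans (neg_le_abs _)
        · have := hmono hx.le
          rw [hfl₂] at this
          exact this.trans (le_abs_self _)
      linarith [hGK _ h2]
  refine le_liminf_div_of_add_le (C := -(f 0 + C)) fun t ht => ?_
  -- The lower bound for `u` is the upper bound for `-u`, with data `-θ` and Hamiltonian `p ↦ -G
  -- (-p)`.
  have := hu.super.neg.le_add_mul (θ := -θ)
    (uniformContinuous_neg.comp_uniformContinuousOn hu.uniformContinuousOn)
    (fun x => by rw [hu.initial]; ring) hf (by rwa [abs_neg]) hC hsup ht 0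
  linarith

/-- On a valley of height `h` that is wide enough, every solution grows at rate at most `r`. -/
theorem upperRate_le_of_valley {a V G : ℝ → ℝ} {β θ h ε K η m r l₁ l₂ δ : ℝ} (hβ : 0 ≤ β)
    (ha : Continuous a) (ha0 : ∀ x, 0 ≤ a x) (hV : ∀ x, V x ∈ Set.Icc (0 : ℝ) 1)
    (hε : 0 < ε) (hK : |θ| < K) (hη : 0 < η)
    (hGm : ∀ p, |p| ≤ K → G p ≤ m) (hGK : ∀ p, K ≤ |p| → |p| ≤ K + η → G p ≤ ε)
    (hr₁ : ε + m + β * h ≤ r) (hr₂ : ε + ε + β ≤ r) (hl : l₁ ≤ l₂) (hδ : 0 < δ)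
    (hint : ∫ x in l₁..l₂, 1 / max (a x) δ = 2 * (K / ε))
    (hvalley : ∀ x ∈ Set.Icc l₁ l₂, V x ≤ h) :
    upperRate a V β G θ ≤ (r : EReal) := by
  refine iSup₂_le fun u hu => ?_
  have hm : ∀ x, 0 < max (a x) δ := fun x => lt_max_of_lt_right hδ
  -- Since `g ≤ (ε / δ) * ρ`, this decay rate makes the slope gained on each side at most `η`.
  set k := ε / δ / η with hk
  have hk0 : 0 < k := by positivity
  have hMk : ε / δ / k = η := by rw [hk]; field_simp
  -- The sum of the two maxima is the distance to `[l₁, l₂]`, so `ρ = 1` in the valley and the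
  -- integral there is unchanged.
  set ρ : ℝ → ℝ := fun x => Real.exp (-k * (max 0 (l₁ - x) + max 0 (x - l₂))) with hρ
  have hρ0 : ∀ x, 0 < ρ x := fun x => Real.exp_pos _
  have hρ1 : ∀ x, ρ x ≤ 1 := fun x => Real.exp_le_one_iff.2 (by
    have h1 : 0 ≤ max 0 (l₁ - x) := le_max_left _ _
    have h2 : 0 ≤ max 0 (x - l₂) := le_max_left _ _
    nlinarith)
  have hρc : Continuous ρ := by simp only [hρ]; fun_prop
  set g : ℝ → ℝ := fun x => ρ x * (ε / max (a x) δ) with hgdef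
  have hg : Continuous g :=
    hρc.mul (continuous_const.div (ha.max continuous_const) fun x => (hm x).ne')
  have hg0 : ∀ x, 0 ≤ g x := fun x => mul_nonneg (hρ0 x).le (div_pos hε (hm x)).le
  have hgρ : ∀ x, g x ≤ ε / δ * ρ x := fun x => by
    simp only [hgdef]
    rw [mul_comm]
    have : ε / max (a x) δ ≤ ε / δ := by gcongr; exact le_max_right _ _
    exact mul_le_mul_of_nonneg_right this (hρ0 x).le
  have hint' : ∫ x in l₁..l₂, g x = 2 * K := by
    have h1 : ∫ x in l₁..l₂, g x = ∫ x in l₁..l₂, ε * (1 / max (a x) δ) := by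
      refine intervalIntegral.integral_congr fun x hx => ?_
      rw [Set.uIcc_of_le hl] at hx
      have h2 : ρ x = 1 := by
        simp only [hρ]
        rw [max_eq_left (by linarith [hx.1]), max_eq_left (by linarith [hx.2])]
        simp
      simp only [hgdef, h2]
      ring
    rw [h1, intervalIntegral.integral_const_mul, hint]
    field_simp
  have hK0 : 0 ≤ K := (abs_nonneg θ).trans hK.le
  obtain ⟨f, hf, hf2, hmono, hf₁, hf₂, C, hC⟩ := exists_convex_barrier hg hg0 hK0 hint'
  have hsup : ∀ x, a x * iteratedDeriv 2 f x + G (deriv f x) + β * V x ≤ r := by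
    intro x
    have h1 : a x * g x ≤ ε := by
      refine le_trans (mul_le_mul_of_nonneg_left ?_ (ha0 x)) (mul_div_max_le hδ hε.le)
      exact mul_le_of_le_one_left (div_pos hε (hm x)).le (hρ1 x)
    have hfl₁ : deriv f l₁ = -K := by simp [hf₁]
    have hfl₂ : deriv f l₂ = K := by simp [hf₂]
    have hVx := mul_le_mul_of_nonneg_left (hV x).2 hβ
    rw [hf2]
    by_cases hx : x ∈ Set.Icc l₁ l₂
    · have h2 := mul_le_mul_of_nonneg_left (hvalley x hx) hβ
      have h3 : |deriv f x| ≤ K := by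
        rw [abs_le, ← hfl₁]
        exact ⟨hmono hx.1, (hmono hx.2).trans hfl₂.le⟩
      linarith [hGm _ h3]
    · have h2 : K ≤ |deriv f x| ∧ |deriv f x| ≤ K + η := by
        rw [Set.mem_Icc, not_and_or, not_le, not_le] at hx
        rcases hx with hx | hx
        · have h3 := hmono hx.le
          have h4 := integral_le_of_le_exp_left hg (M := ε / δ) (by positivity) hk0 hx.le
            fun s hs => (hgρ s).trans_eq (by
              simp only [hρ]
              rw [max_eq_right (by linarith), max_eq_left (by linarith), add_zero])
          rw [hMk] at h4
          rw [hfl₁] at h3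
          have h5 := hf₁ x
          rw [intervalIntegral.integral_symm] at h5
          rw [abs_of_nonpos (by linarith)]
          constructor <;> linarith
        · have h3 := hmono hx.le
          have h4 := integral_le_of_le_exp hg (M := ε / δ) (by positivity) hk0 hx.le
            fun s hs => (hgρ s).trans_eq (by
              simp only [hρ]
              rw [max_eq_left (by linarith), max_eq_right (by linarith), zero_add])
          rw [hMk] at h4
          rw [hfl₂] at h3
          have h5 := hf₂ x
          rw [abs_of_nonneg (by linarith)]
          constructor <;> linarith
      linarith [hGK _ h2.1 h2.2]
  refine limsup_div_le_of_le_add (C := f 0 + C) fun t ht => ?_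
  have := hu.sub.le_add_mul hu.uniformContinuousOn hu.initial hf hK hC hsup ht 0
  linarith

/-! ### Choice of constants and the limit `ε → 0`. -/

theorem HamiltonianClass.exists_le_of_le_abs {γ α₀ α₁ : ℝ} {G : ℝ → ℝ}
    (hG : HamiltonianClass γ α₀ α₁ G) (hγ : 1 ≤ γ) (hα₀ : 0 < α₀) (β θ : ℝ) :
    ∃ K, |θ| < K ∧ ∀ p, K ≤ |p| → β ≤ G p := by
  -- The first entry forces `|p| ≥ 1`, hence `|p| ^ γ ≥ |p|`; the second then solves `α₀ * |p| - 1 /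
  -- α₀ ≥ β`.
  refine ⟨max (|θ| + 1) ((β + 1 / α₀) / α₀), lt_max_of_lt_left (by linarith), fun p hp => ?_⟩
  have h1 : 1 ≤ |p| := by linarith [(le_max_left _ _).trans hp, abs_nonneg θ]
  have h2 := (le_max_right _ _).trans hp
  rw [div_le_iff₀ hα₀] at h2
  have h3 := mul_le_mul_of_nonneg_left (Real.self_le_rpow_of_one_le h1 hγ) hα₀.le
  linarith [hG.lower p]

/-- The valley barrier uses `K = c + η`, strictly above `|θ|`, and its slopes may overshoot by
another `η`; continuity at the zeros `±c` absorbs both. -/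
theorem exists_bound_near_zeros {G : ℝ → ℝ} (hG : Continuous G) {c ε : ℝ}
    (hc : 0 ≤ c) (hGc : G c = 0) (hGc' : G (-c) = 0) (hε : 0 < ε) :
    ∃ η, 0 < η ∧ (∀ p, c ≤ |p| → |p| ≤ c + η + η → G p ≤ ε) ∧
      ∀ p, |p| ≤ c + η → G p ≤ sSup (G '' Set.Icc (-c) c) + ε := by
  obtain ⟨d₁, hd₁, h₁⟩ := Metric.continuous_iff.1 hG c ε hε
  obtain ⟨d₂, hd₂, h₂⟩ := Metric.continuous_iff.1 hG (-c) ε hε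
  have hd : 0 < min d₁ d₂ := lt_min hd₁ hd₂
  have hnear : ∀ p, c ≤ |p| → |p| ≤ c + min d₁ d₂ / 3 + min d₁ d₂ / 3 → G p ≤ ε := by
    intro p hp hp'
    have hm₁ := min_le_left d₁ d₂
    have hm₂ := min_le_right d₁ d₂
    rcases abs_cases p with ⟨h, -⟩ | ⟨h, -⟩ <;> rw [h] at hp hp'
    · have := h₁ p (by rw [Real.dist_eq, abs_lt]; constructor <;> linarith)
      rw [Real.dist_eq, hGc, sub_zero] at this
      exact (le_abs_self _).trans this.le
    · have := h₂ p (by rw [Real.dist_eq, abs_lt]; constructor <;> linarith)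
      rw [Real.dist_eq, hGc', sub_zero] at this
      exact (le_abs_self _).trans this.le
  have hbdd : BddAbove (G '' Set.Icc (-c) c) :=
    (isCompact_Icc.image hG).bddAbove
  have hsup : ∀ p, |p| ≤ c → G p ≤ sSup (G '' Set.Icc (-c) c) := fun p hp =>
    le_csSup hbdd ⟨p, abs_le.1 hp, rfl⟩
  refine ⟨min d₁ d₂ / 3, by positivity, hnear, fun p hp => ?_⟩
  rcases le_total |p| c with h | h
  · linarith [hsup p h]
  · linarith [hnear p h (by linarith), hsup c (abs_of_nonneg hc).le]

theorem EReal.le_of_forall_pos_sub_le {x : ℝ} {y : EReal}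
    (h : ∀ ε : ℝ, 0 < ε → ε < 1 → ((x - ε : ℝ) : EReal) ≤ y) : (x : EReal) ≤ y := by
  have hlim : Tendsto (fun ε : ℝ => ((x - ε : ℝ) : EReal)) (𝓝[>] 0) (𝓝 (x : EReal)) := by
    refine (continuous_coe_real_ereal.tendsto x).comp (tendsto_nhdsWithin_of_tendsto_nhds ?_)
    simpa using (by fun_prop : Continuous fun ε : ℝ => x - ε).tendsto 0
  refine le_of_tendsto hlim ?_
  filter_upwards [Ioo_mem_nhdsGT one_pos] with ε hε using h ε hε.1 hε.2

theorem EReal.le_of_forall_pos_le_add_mul {x C : ℝ} {y : EReal}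
    (h : ∀ ε : ℝ, 0 < ε → ε < 1 → y ≤ ((x + C * ε : ℝ) : EReal)) : y ≤ (x : EReal) := by
  have hlim : Tendsto (fun ε : ℝ => ((x + C * ε : ℝ) : EReal)) (𝓝[>] 0) (𝓝 (x : EReal)) := by
    refine (continuous_coe_real_ereal.tendsto x).comp (tendsto_nhdsWithin_of_tendsto_nhds ?_)
    simpa using (by fun_prop : Continuous fun ε : ℝ => x + C * ε).tendsto 0
  refine ge_of_tendsto hlim ?_
  filter_upwards [Ioo_mem_nhdsGT one_pos] with ε hε using h ε hε.1 hε.2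

theorem mainTheorem8 {Ω : Type*} [MeasurableSpace Ω] (P : Measure Ω) [IsProbabilityMeasure P]
    (τ : ℝ → Ω → Ω) (κ : ℝ≥0) (hκ : 0 < κ) (a V : ℝ → Ω → ℝ) (hM : IsMedium P τ κ a V)
    (β : ℝ) (hβ : 0 ≤ β)
    (γ α₀ α₁ : ℝ) (hγ : 1 < γ) (hα₀ : 0 < α₀) (hα₁ : 0 < α₁)
    (G : ℝ → ℝ) (hG : HamiltonianClass γ α₀ α₁ G) (hG0 : ∀ p : ℝ, 0 ≤ G p) :
    (ScaledHill P a V →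
      ∀ θ : ℝ, (β : EReal) ≤ effectiveLower P a V β G θ) ∧
    (ScaledValley P a V →
      ∀ c : ℝ, 0 ≤ c → G c = 0 → G (-c) = 0 → ∀ θ : ℝ, |θ| ≤ c →
        effectiveUpper P a V β G θ ≤ ((max β (sSup (G '' Set.Icc (-c) c)) : ℝ) : EReal)) := by
  have hac : ∀ ω, Continuous fun x => a x ω := fun ω =>
    continuous_of_continuous_sqrt (hM.a_lipschitz ω).continuous fun x => (hM.a_mem x ω).1
  constructor
  · intro hhill θ
    obtain ⟨K, hK, hGK⟩ := hG.exists_le_of_le_abs hγ.le hα₀ β θ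
    have hK0 : 0 < K := (abs_nonneg θ).trans_lt hK
    refine EReal.le_of_forall_pos_sub_le fun ε hε hε1 => le_essInf_of_ae_le _ ?_
    have hb : 0 < β + 1 := by linarith
    -- The hill height loses `β * (1 - h) ≤ ε / 2` and diffusion the other `ε / 2`; dividing by `β +
    -- 1` allows `β = 0`.
    have hh : ε / 2 / (β + 1) < 1 := by rw [div_lt_one hb]; linarith
    have hh0 : 0 < ε / 2 / (β + 1) := by positivity
    filter_upwards [hhill (1 - ε / 2 / (β + 1)) ⟨by linarith, by linarith⟩ (K / (ε / 2))
      (by positivity)] with ω hω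
    obtain ⟨l₁, l₂, δ, -, hδ, hint, hV⟩ := hω
    refine le_trans ?_ (le_lowerRate_of_hill hβ (hac ω) (fun x => hM.V_mem x ω) hG0
      (half_pos hε) (by linarith) hK hGK hδ.1 hint hV)
    rw [EReal.coe_le_coe_iff]
    have : (β + 1) * (ε / 2 / (β + 1)) = ε / 2 := by field_simp
    linarith
  · intro hvalley c hc hGc hGc' θ hθ
    -- In the valley the errors are `ε` from diffusion, `ε` from the bound on `G`, and `β * ε` from
    -- the valley height `ε`.
    refine EReal.le_of_forall_pos_le_add_mul (C := 2 + β) fun ε hε hε1 => essSup_le_of_ae_le _ ?_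
    obtain ⟨η, hη, hnear, hsup⟩ := exists_bound_near_zeros hG.continuous hc hGc hGc' hε
    filter_upwards [hvalley ε ⟨hε, hε1⟩ ((c + η) / ε) (by positivity)] with ω hω
    obtain ⟨l₁, l₂, δ, hl, hδ, hint, hV⟩ := hω
    have hm₁ := le_max_left β (sSup (G '' Set.Icc (-c) c))
    have hm₂ := le_max_right β (sSup (G '' Set.Icc (-c) c))
    have hβε := mul_nonneg hβ hε.le
    exact upperRate_le_of_valley hβ (hac ω) (fun x => (hM.a_mem x ω).1) (fun x => hM.V_mem x ω)
      hε (by linarith) hη hsup (fun p hp hp' => hnear p (by linarith) hp') (by linarith)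
      (by linarith) hl.le hδ.1 hint hV
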